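/- Let $(t_{n,k})_{n,k\ge 0}$ be the sequence of rational numbers defined by $t_{n,0}=1$ for all $n\ge 0$ and \[ t_{n,k}=\frac{n+2k-1}{2}\,t_{n,k-1}+\frac{n-k}{2}\,t_{n+1,k-1}\qquad (n\ge 0,\ k\ge 1). \] Put \[ \rho=\frac23\left(\sqrt2-1\right),\qquad \gamma_0=\frac12\sqrt{\frac{3}{\sqrt2\,\pi}\left(\sqrt2-1\right)},\qquad \gamma_i=\left(\frac{1}{\sqrt2-1}\right)^{i}\gamma_0\quad(i\in\mathbb Z). \] Then, for every fixed integer $i$ (in particular for every $i\ge -1$), \[ t_{k+i,k}\;\sim\;\gamma_i\,\frac{\rho^{-k}}{\sqrt k}\,k!\qquad (k\to\infty), \] that is, the quotient of the two sides tends to $1$ as $k\to\infty$ (with $k\ge\max(1,-i)$). -/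

import Mathlib

namespace ArchProcess

/-- The bivariate sequence `t_{n,k}` (`n, k ≥ 0`) attached to the arch processes: `t_{n,0} = 1` and,
for `k ≥ 1`, `t_{n,k} = (n + 2k - 1)/2 * t_{n,k-1} + (n - k)/2 * t_{n+1,k-1}`.
The factor `n - k` is a subtraction of rational numbers and may be negative. -/
def t : ℕ → ℕ → ℚ
  | _, 0 => 1
  | n, k + 1 =>
      ((n : ℚ) + 2 * ((k : ℚ) + 1) - 1) / 2 * t n k
        + ((n : ℚ) - ((k : ℚ) + 1)) / 2 * t (n + 1) k

/-- The dominant singularity `ρ = (2/3)(√2 - 1)`. -/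
noncomputable def rho : ℝ := 2 / 3 * (√2 - 1)

/-- The constant `γ₀ = (1/2) √( 3/(√2 π) * (√2 - 1) )`. -/
noncomputable def gammaZero : ℝ := 1 / 2 * √(3 / (√2 * Real.pi) * (√2 - 1))

/-- The constants `γ_i = (1/(√2 - 1))^i γ₀`, for `i` an integer. -/
noncomputable def gamma (i : ℤ) : ℝ := (1 / (√2 - 1)) ^ i * gammaZero

end ArchProcess

/-!
The recurrence is linear, and along the diagonals `n - k = i` it is solved by a contour integral.
With `z(w) = w - w² + w³/6`,
`t_{k+i,k} = k! · (2πi)⁻¹ ∮ (1 - w)^{1-i} z(w)^{-(k+1)} dw`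
on a circle around `0` of radius less than `1`. Indeed the combination of three such integrands that
the recurrence asks to integrate to zero is the derivative of
`-(2 - w)/2 · (1 - w)^{-i} z(w)^{-k}` (`contourIntegral_succ`), and for `k = 0` the integral is given
by Cauchy's formula (`contourIntegral_zero`). These two facts yield `t_eq_factorial_mul`.

The function `z` has a critical point at `w = 2 - √2`, where its value is `ρ`. The circle of
integration is taken through this saddle point. On it `|z|` is minimal exactly at the saddle, with a
quadratic lower bound (`one_add_sq_le_norm_saddleRatio`), and `z` has the expansion
`z/ρ = 1 + (3√2(√2-1)/2) θ² + o(θ²)` in the angle `θ` (`tendsto_saddleRatio`). Laplace's method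
(`tendsto_sqrt_mul_integral_inv_pow`, a dominated convergence argument after rescaling `θ` by `√k`)
then gives the asymptotics, the Gaussian integral producing the constant `γ_i`.
-/

open Filter Topology MeasureTheory

namespace ArchProcess

/-! ### The contour integral and the recurrence -/

/-- The cubic `w - w² + w³/6`, whose local inverse at `0` governs the generating functions
`∑ t_{k+i,k} z^k / k!`. -/
noncomputable def cubic (w : ℂ) : ℂ := w * (1 - w + w ^ 2 / 6)

/-- The critical point `2 - √2` of `cubic` closest to `0`, used as the radius of integration. -/
noncomputable def saddle : ℝ := 2 - √2

/-- The integral `(2πi)⁻¹ ∮ (1 - w)^{1-i} z(w)^{-(k+1)} dw` over the circle through the saddle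
point; it is `t_{k+i,k} / k!`. -/
noncomputable def contourIntegral (i : ℤ) (k : ℕ) : ℂ :=
  (2 * Real.pi * Complex.I)⁻¹ *
    ∮ w in C(0, saddle), (1 - w) ^ (1 - i) * (cubic w ^ (k + 1))⁻¹

lemma saddle_pos : 0 < saddle := by
  have : √2 < 2 := by rw [Real.sqrt_lt' (by norm_num)]; norm_num
  unfold saddle; linarith

lemma saddle_lt : saddle < 3 / 5 := by
  have : 7 / 5 < √2 := by rw [Real.lt_sqrt (by norm_num)]; norm_num
  unfold saddle; linarith

lemma one_sub_ne_zero_of_norm_le {w : ℂ} (hw : ‖w‖ ≤ saddle) : 1 - w ≠ 0 := by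
  intro h
  have h1 : w = 1 := (sub_eq_zero.mp h).symm
  rw [h1, norm_one] at hw
  linarith [saddle_lt]

lemma quadratic_ne_zero_of_norm_le {w : ℂ} (hw : ‖w‖ ≤ saddle) : 1 - w + w ^ 2 / 6 ≠ 0 := by
  intro h
  have h1 : (1 : ℂ) = w - w ^ 2 / 6 := by linear_combination h
  have h2 : (1 : ℝ) ≤ ‖w‖ + ‖w‖ ^ 2 / 6 := by
    calc (1 : ℝ) = ‖w - w ^ 2 / 6‖ := by rw [← h1, norm_one]
      _ ≤ ‖w‖ + ‖w ^ 2 / 6‖ := norm_sub_le _ _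
      _ = ‖w‖ + ‖w‖ ^ 2 / 6 := by simp
  nlinarith [saddle_lt, norm_nonneg w]

lemma cubic_ne_zero_of_norm_eq {w : ℂ} (hw : ‖w‖ = saddle) : cubic w ≠ 0 := by
  refine mul_ne_zero ?_ (quadratic_ne_zero_of_norm_le hw.le)
  rw [← norm_pos_iff, hw]
  exact saddle_pos

lemma hasDerivAt_cubic (w : ℂ) : HasDerivAt cubic (1 - 2 * w + w ^ 2 / 2) w := by
  have h1 : HasDerivAt (fun w : ℂ => 1 - w + w ^ 2 / 6) (-1 + (2 * w) / 6) w := by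
    simpa using ((hasDerivAt_id w).const_sub 1).fun_add (((hasDerivAt_id w).fun_pow 2).div_const 6)
  convert! (hasDerivAt_id w).mul h1 using 1
  simp only [id]
  ring

lemma continuous_cubic : Continuous cubic := by unfold cubic; fun_prop

lemma contourIntegral_zero (i : ℤ) : contourIntegral i 0 = 1 := by
  have hd : DifferentiableOn ℂ (fun w : ℂ => (1 - w) ^ (1 - i) * (1 - w + w ^ 2 / 6)⁻¹)
      (Metric.closedBall 0 saddle) := by
    intro w hw
    have hw' : ‖w‖ ≤ saddle := by simpa using hw
    have h1 : DifferentiableAt ℂ (fun w : ℂ => (1 - w) ^ (1 - i)) w :=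
      DifferentiableAt.zpow (by fun_prop) (Or.inl (one_sub_ne_zero_of_norm_le hw'))
    have h2 : DifferentiableAt ℂ (fun w : ℂ => (1 - w + w ^ 2 / 6)⁻¹) w :=
      DifferentiableAt.inv (by fun_prop) (quadratic_ne_zero_of_norm_le hw')
    exact (h1.mul h2).differentiableWithinAt
  have h := hd.circleIntegral_sub_inv_smul (w := 0) (by simpa using saddle_pos)
  have hpi : (2 * Real.pi * Complex.I : ℂ) ≠ 0 := Complex.two_pi_I_ne_zero
  have hint : (∮ w in C(0, saddle), (1 - w) ^ (1 - i) * (cubic w ^ (0 + 1))⁻¹)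
      = 2 * Real.pi * Complex.I := by
    simp only [smul_eq_mul, sub_zero, one_zpow] at h
    norm_num at h
    rw [← h]
    congr 1
    funext w
    simp only [cubic, mul_inv, zero_add, pow_one]
    ring
  rw [contourIntegral, hint, inv_mul_cancel₀ hpi]

lemma circleIntegrable_contour (m : ℤ) (k : ℕ) :
    CircleIntegrable (fun w : ℂ => (1 - w) ^ m * (cubic w ^ k)⁻¹) 0 saddle := by
  refine ContinuousOn.circleIntegrable saddle_pos.le ?_
  intro w hw
  have hw' : ‖w‖ = saddle := by simpa using hw
  refine ContinuousAt.continuousWithinAt (ContinuousAt.mul ?_ ?_)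
  · exact ContinuousAt.zpow₀ (by fun_prop) _ (Or.inl (one_sub_ne_zero_of_norm_le hw'.le))
  · exact ContinuousAt.inv₀ (continuous_cubic.continuousAt.pow k)
      (pow_ne_zero _ (cubic_ne_zero_of_norm_eq hw'))

/-- The integrands of the recurrence combine to an exact derivative. -/
lemma hasDerivAt_primitive (i : ℤ) (k : ℕ) {w : ℂ} (hc : 1 - w ≠ 0) (hz : cubic w ≠ 0) :
    HasDerivAt (fun w : ℂ => -((2 - w) / 2 * (1 - w) ^ (-i) * (cubic w ^ (k + 1))⁻¹))
      ((k + 1) * ((1 - w) ^ (1 - i) * (cubic w ^ (k + 1 + 1))⁻¹)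
        - ((3 * (k + 1) + i - 1) / 2 * ((1 - w) ^ (1 - (i + 1)) * (cubic w ^ (k + 1))⁻¹)
          + i / 2 * ((1 - w) ^ (1 - (i + 2)) * (cubic w ^ (k + 1))⁻¹))) w := by
  have h1 : HasDerivAt (fun w : ℂ => (2 - w) / 2) (-1 / 2) w := by
    simpa using ((hasDerivAt_id w).const_sub 2).div_const 2
  have h2 : HasDerivAt (fun w : ℂ => (1 - w) ^ (-i))
      (((-i : ℤ) : ℂ) * (1 - w) ^ (-i - 1) * (-1)) w :=
    (hasDerivAt_zpow (-i) (1 - w) (Or.inl hc)).comp w ((hasDerivAt_id w).const_sub 1)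
  have h3 : HasDerivAt (fun w : ℂ => (cubic w ^ (k + 1))⁻¹) _ w :=
    ((hasDerivAt_cubic w).fun_pow (k + 1)).fun_inv (pow_ne_zero _ hz)
  convert! ((h1.fun_mul h2).fun_mul h3).fun_neg using 1
  have e1 : (1 - w) ^ (1 - i) = (1 - w) * (1 - w) ^ (-i) := by
    rw [show 1 - i = 1 + -i by ring, zpow_add₀ hc, zpow_one]
  have e2 : (1 - w) ^ (1 - (i + 1)) = (1 - w) ^ (-i) := by congr 1; ring
  have e3 : (1 - w) ^ (1 - (i + 2)) = (1 - w) ^ (-i) * (1 - w)⁻¹ := by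
    rw [← zpow_sub_one₀ hc]; congr 1; ring
  have e4 : (1 - w) ^ (-i - 1) = (1 - w) ^ (-i) * (1 - w)⁻¹ := zpow_sub_one₀ hc _
  simp only [e1, e2, e3, e4]
  generalize (1 - w) ^ (-i) = c
  have hw : cubic w = w * (1 - w + w ^ 2 / 6) := rfl
  simp only [Nat.add_sub_cancel]
  push_cast
  generalize cubic w = z at *
  field_simp
  rw [hw]
  ring

lemma contourIntegral_succ (i : ℤ) (k : ℕ) :
    (k + 1) * contourIntegral i (k + 1)
      = (3 * (k + 1) + i - 1) / 2 * contourIntegral (i + 1) k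
        + i / 2 * contourIntegral (i + 2) k := by
  have h := circleIntegral.integral_eq_zero_of_hasDerivWithinAt (c := 0) saddle_pos.le
    (fun w hw => (hasDerivAt_primitive i k
      (one_sub_ne_zero_of_norm_le (by simpa using hw.le))
      (cubic_ne_zero_of_norm_eq (by simpa using hw))).hasDerivWithinAt)
  have hci (c : ℂ) (m : ℤ) (l : ℕ) :
      CircleIntegrable (fun w => c * ((1 - w) ^ m * (cubic w ^ l)⁻¹)) 0 saddle :=
    (circleIntegrable_contour m l).const_smul
  have hadd (c c' : ℂ) (m m' : ℤ) (l : ℕ) :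
      CircleIntegrable (fun w => c * ((1 - w) ^ m * (cubic w ^ l)⁻¹)
        + c' * ((1 - w) ^ m' * (cubic w ^ l)⁻¹)) 0 saddle :=
    (hci c m l).add (hci c' m' l)
  rw [circleIntegral.integral_sub (hci _ _ _) (hadd _ _ _ _ _),
    circleIntegral.integral_add (hci _ _ _) (hci _ _ _), circleIntegral.integral_const_mul,
    circleIntegral.integral_const_mul, circleIntegral.integral_const_mul] at h
  unfold contourIntegral
  linear_combination (2 * Real.pi * Complex.I : ℂ)⁻¹ * h

theorem t_eq_factorial_mul (n k : ℕ) :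
    (t n k : ℂ) = k.factorial * contourIntegral ((n : ℤ) - k) k := by
  induction k generalizing n with
  | zero => simp [t, contourIntegral_zero]
  | succ k ih =>
    have h := contourIntegral_succ ((n : ℤ) - (k + 1)) k
    have e1 : (n : ℤ) - (k + 1) + 1 = n - k := by ring
    have e2 : (n : ℤ) - (k + 1) + 2 = ((n + 1 : ℕ) : ℤ) - k := by push_cast; ring
    rw [e1, e2] at h
    rw [t, Nat.factorial_succ]
    push_cast at h ⊢
    have ih1 := ih n
    have ih2 := ih (n + 1)
    push_cast at ih1 ih2
    rw [ih1, ih2]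
    linear_combination (-(k.factorial : ℂ)) * h

/-! ### Laplace's method -/

/-- Laplace's method for a complex-valued phase: `h` has a strict minimum of its modulus at `0`, and
`h θ = 1 + a θ² / 2 + o(θ²)` there. -/
theorem tendsto_sqrt_mul_integral_inv_pow {G h : ℝ → ℂ} {a c : ℝ} (hG : Continuous G)
    (hh : Continuous h) (hc : 0 < c)
    (hlow : ∀ θ ∈ Set.Icc (-Real.pi) Real.pi, 1 + c * θ ^ 2 ≤ ‖h θ‖)
    (hquad : Tendsto (fun θ : ℝ => (h θ - 1) / (θ : ℂ) ^ 2) (𝓝[≠] 0) (𝓝 ((a / 2 : ℝ) : ℂ))) :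
    Tendsto (fun k : ℕ => (√(k : ℝ) : ℂ) * ∫ θ in -Real.pi..Real.pi, G θ * (h θ ^ k)⁻¹) atTop
      (𝓝 (G 0 * (√(2 * Real.pi / a) : ℝ))) := by
  obtain ⟨M, hM⟩ := isCompact_Icc.exists_bound_of_continuousOn
    (hG.continuousOn (s := Set.Icc (-Real.pi) Real.pi))
  have hM0 : 0 ≤ M := (norm_nonneg _).trans (hM 0 ⟨by linarith [Real.pi_pos], Real.pi_pos.le⟩)
  set F : ℕ → ℝ → ℂ := fun k s =>
    (Set.Ioc (-(Real.pi * √k)) (Real.pi * √k)).indicator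
      (fun s => G (s / √k) * (h (s / √k) ^ k)⁻¹) s with hF
  have hscale : ∀ᶠ k : ℕ in atTop, ∫ s, F k s
      = (√(k : ℝ) : ℂ) * ∫ θ in -Real.pi..Real.pi, G θ * (h θ ^ k)⁻¹ := by
    filter_upwards [eventually_gt_atTop 0] with k hk
    have hk' : 0 < √(k : ℝ) := Real.sqrt_pos.mpr (by exact_mod_cast hk)
    have hle : -(Real.pi * √k) ≤ Real.pi * √k := by
      have := mul_pos Real.pi_pos hk'; linarith
    rw [hF]
    simp only
    rw [integral_indicator measurableSet_Ioc, ← intervalIntegral.integral_of_le hle,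
      intervalIntegral.integral_comp_div (fun θ => G θ * (h θ ^ k)⁻¹) hk'.ne',
      neg_div, mul_div_cancel_right₀ _ hk'.ne', Complex.real_smul]
  have hlim : ∀ s : ℝ, s ≠ 0 → Tendsto (fun k => F k s) atTop
      (𝓝 (G 0 * (Real.exp (-(a / 2) * s ^ 2) : ℝ))) := by
    intro s hs
    have hsqrt : Tendsto (fun k : ℕ => √(k : ℝ)) atTop atTop :=
      Real.tendsto_sqrt_atTop.comp tendsto_natCast_atTop_atTop
    have h0 : Tendsto (fun k : ℕ => s / √(k : ℝ)) atTop (𝓝 0) := hsqrt.const_div_atTop s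
    have h0' : Tendsto (fun k : ℕ => s / √(k : ℝ)) atTop (𝓝[≠] 0) := by
      refine tendsto_nhdsWithin_iff.mpr ⟨h0, ?_⟩
      filter_upwards [eventually_gt_atTop 0] with k hk
      exact div_ne_zero hs (Real.sqrt_pos.mpr (by exact_mod_cast hk)).ne'
    have hpow : Tendsto (fun k : ℕ => h (s / √k) ^ k) atTop
        (𝓝 (Complex.exp ((s : ℂ) ^ 2 * (a / 2 : ℝ)))) := by
      have hg : Tendsto (fun k : ℕ => (k : ℂ) * (h (s / √k) - 1)) atTop
          (𝓝 ((s : ℂ) ^ 2 * (a / 2 : ℝ))) := by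
        refine ((hquad.comp h0').const_mul ((s : ℂ) ^ 2)).congr' ?_
        filter_upwards [eventually_gt_atTop 0] with k hk
        have hk2 : ((√(k : ℝ) : ℝ) : ℂ) ^ 2 = k := by
          rw [← Complex.ofReal_pow, Real.sq_sqrt (Nat.cast_nonneg k), Complex.ofReal_natCast]
        have hk0 : (k : ℂ) ≠ 0 := by exact_mod_cast hk.ne'
        have hs' : (s : ℂ) ≠ 0 := by exact_mod_cast hs
        simp only [Function.comp, Complex.ofReal_div, div_pow, hk2]
        field_simp
      have := Complex.tendsto_one_add_pow_exp_of_tendsto hg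
      simpa using this
    have hmain : Tendsto (fun k : ℕ => G (s / √k) * (h (s / √k) ^ k)⁻¹) atTop
        (𝓝 (G 0 * (Real.exp (-(a / 2) * s ^ 2) : ℝ))) := by
      have e : ((Real.exp (-(a / 2) * s ^ 2) : ℝ) : ℂ)
          = (Complex.exp ((s : ℂ) ^ 2 * (a / 2 : ℝ)))⁻¹ := by
        rw [← Complex.exp_neg]; push_cast; congr 1; ring
      rw [e]
      exact ((hG.tendsto 0).comp h0).mul (hpow.inv₀ (Complex.exp_ne_zero _))
    refine hmain.congr' ?_
    have hev : ∀ᶠ k : ℕ in atTop, |s| / Real.pi < √(k : ℝ) := hsqrt.eventually_gt_atTop _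
    filter_upwards [hev] with k hk
    rw [div_lt_iff₀ Real.pi_pos, mul_comm] at hk
    have hmem : s ∈ Set.Ioc (-(Real.pi * √k)) (Real.pi * √k) :=
      ⟨(abs_lt.mp hk).1, (abs_lt.mp hk).2.le⟩
    rw [hF]
    simp only [Set.indicator_of_mem hmem]
  -- Bernoulli's inequality turns the lower bound for `h` into an integrable majorant.
  have hbound : ∀ᶠ k : ℕ in atTop, ∀ᵐ s : ℝ, ‖F k s‖ ≤ M * (1 + (√c * s) ^ 2)⁻¹ := by
    filter_upwards [eventually_gt_atTop 0] with k hk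
    refine Eventually.of_forall fun s => ?_
    have hk0 : (0 : ℝ) < k := by exact_mod_cast hk
    have hk' : 0 < √(k : ℝ) := Real.sqrt_pos.mpr hk0
    have hpos : 0 ≤ M * (1 + (√c * s) ^ 2)⁻¹ := by positivity
    by_cases hs : s ∈ Set.Ioc (-(Real.pi * √k)) (Real.pi * √k)
    · have hθ : s / √k ∈ Set.Icc (-Real.pi) Real.pi := by
        constructor
        · rw [le_div_iff₀ hk']; linarith [hs.1]
        · rw [div_le_iff₀ hk']; exact hs.2
      have hB : 1 + (√c * s) ^ 2 ≤ ‖h (s / √k) ^ k‖ := by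
        rw [norm_pow]
        calc 1 + (√c * s) ^ 2 = 1 + k * (c * (s / √k) ^ 2) := by
              rw [mul_pow, Real.sq_sqrt hc.le, div_pow, Real.sq_sqrt hk0.le]; field_simp
          _ ≤ (1 + c * (s / √k) ^ 2) ^ k := by
              refine one_add_mul_le_pow ?_ k
              have : 0 ≤ c * (s / √k) ^ 2 := by positivity
              linarith
          _ ≤ _ := by
              have := hlow _ hθ
              gcongr
      rw [hF]
      simp only [Set.indicator_of_mem hs, norm_mul, norm_inv]
      have := hM _ hθ
      gcongr
    · rw [hF]
      simp only [Set.indicator_of_notMem hs, norm_zero]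
      exact hpos
  have hint : Integrable (fun s : ℝ => M * (1 + (√c * s) ^ 2)⁻¹) :=
    (integrable_inv_one_add_sq.comp_mul_left' (Real.sqrt_pos.mpr hc).ne').const_mul M
  have hmeas : ∀ᶠ k : ℕ in atTop, AEStronglyMeasurable (F k) volume := by
    refine Eventually.of_forall fun k => ?_
    refine AEStronglyMeasurable.indicator ?_ measurableSet_Ioc
    refine Measurable.aestronglyMeasurable ?_
    have h1 : Measurable fun s : ℝ => G (s / √k) := (hG.comp (by fun_prop)).measurable
    have h2 : Measurable fun s : ℝ => h (s / √k) := (hh.comp (by fun_prop)).measurable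
    exact h1.mul (h2.pow_const k).inv
  have hae : ∀ᵐ s : ℝ, Tendsto (fun k => F k s) atTop
      (𝓝 (G 0 * (Real.exp (-(a / 2) * s ^ 2) : ℝ))) := by
    filter_upwards [(Set.countable_singleton (0 : ℝ)).ae_notMem volume] with s hs
    exact hlim s hs
  have hconv := tendsto_integral_filter_of_dominated_convergence _ hmeas hbound hint hae
  have hgauss : ∫ s : ℝ, G 0 * (Real.exp (-(a / 2) * s ^ 2) : ℝ)
      = G 0 * (√(2 * Real.pi / a) : ℝ) := by
    rw [integral_const_mul, integral_complex_ofReal, integral_gaussian]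
    congr 3
    rw [div_div_eq_mul_div, mul_comm]
  rw [hgauss] at hconv
  exact hconv.congr' hscale

/-! ### The circle through the saddle point -/

/-- The ratio `z(w)/ρ` at the point `w` of angle `θ` on the circle through the saddle point. -/
noncomputable def saddleRatio (θ : ℝ) : ℂ := cubic (circleMap 0 saddle θ) / rho

/-- The part of the integrand that does not depend on `k`, in the angle `θ`. -/
noncomputable def amplitude (i : ℤ) (θ : ℝ) : ℂ :=
  circleMap 0 saddle θ * (1 - circleMap 0 saddle θ) ^ (1 - i) * (cubic (circleMap 0 saddle θ))⁻¹

lemma norm_circleMap_saddle (θ : ℝ) : ‖circleMap 0 saddle θ‖ = saddle := by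
  simp [abs_of_pos saddle_pos]

lemma rho_eq : rho = saddle * (√2 / 3) := by
  unfold rho saddle
  have h : √2 * √2 = 2 := Real.mul_self_sqrt (by norm_num)
  linear_combination (1 / 3) * h

lemma rho_pos : 0 < rho := by
  rw [rho_eq]
  have := saddle_pos
  positivity

/-- Taylor's formula for the cubic at its critical point. -/
lemma cubic_eq_taylor (w : ℂ) :
    cubic w = rho - (√2 : ℝ) / 2 * (w - saddle) ^ 2 + (w - saddle) ^ 3 / 6 := by
  have h : ((√2 : ℝ) : ℂ) ^ 2 = 2 := by
    rw [← Complex.ofReal_pow, Real.sq_sqrt (by norm_num)]; norm_num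
  simp only [cubic, rho, saddle]
  push_cast
  generalize ((√2 : ℝ) : ℂ) = s at *
  linear_combination (s / 3 + w / 2 - 1) * h

lemma circleMap_saddle_zero : circleMap 0 saddle 0 = saddle := by simp [circleMap]

lemma cubic_saddle : cubic saddle = rho := by simp [cubic_eq_taylor]

lemma continuous_saddleRatio : Continuous saddleRatio :=
  (continuous_cubic.comp (continuous_circleMap 0 saddle)).div_const _

lemma continuous_amplitude (i : ℤ) : Continuous (amplitude i) := by
  have hc := continuous_circleMap 0 saddle
  refine (hc.mul ?_).mul ?_
  · exact (continuous_const.sub hc).zpow₀ _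
      fun θ => Or.inl (one_sub_ne_zero_of_norm_le (norm_circleMap_saddle θ).le)
  · exact (continuous_cubic.comp hc).inv₀
      fun θ => cubic_ne_zero_of_norm_eq (norm_circleMap_saddle θ)

/-- On the circle, `|z|` grows at least quadratically away from the saddle point, because
`|1 - w + w²/6|²` is a quadratic polynomial in `cos θ` that increases with `1 - cos θ`. -/
lemma one_add_sq_le_norm_saddleRatio {θ : ℝ} (hθ : θ ∈ Set.Icc (-Real.pi) Real.pi) :
    1 + 1 / 20 * θ ^ 2 ≤ ‖saddleRatio θ‖ := by
  have hs2 : √2 ^ 2 = 2 := Real.sq_sqrt (by norm_num)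
  have hr1 := saddle_lt
  have hr0 : 1 / 2 < saddle := by
    have : √2 < 3 / 2 := by rw [Real.sqrt_lt' (by norm_num)]; norm_num
    unfold saddle; linarith
  set w := circleMap 0 saddle θ with hw
  have hwre : w.re = saddle * Real.cos θ := by
    simp [hw, circleMap, Complex.exp_ofReal_mul_I_re]
  have hwim : w.im = saddle * Real.sin θ := by
    simp [hw, circleMap, Complex.exp_ofReal_mul_I_im]
  have hnorm : ‖saddleRatio θ‖ = ‖1 - w + w ^ 2 / 6‖ / (√2 / 3) := by
    rw [saddleRatio, ← hw, cubic, rho_eq, norm_div, norm_mul, hw, norm_circleMap_saddle,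
      Complex.norm_real, Real.norm_of_nonneg (by positivity),
      mul_div_mul_left _ _ saddle_pos.ne']
  have hsq : ‖1 - w + w ^ 2 / 6‖ ^ 2 = 2 / 9 + (1 - Real.cos θ) * saddle *
      (2 * (1 + saddle ^ 2 / 6) - 2 * saddle / 3 * (1 + Real.cos θ)) := by
    have h1 : (1 - w + w ^ 2 / 6).re = 1 - w.re + (w.re ^ 2 - w.im ^ 2) / 6 := by
      simp [pow_two]
    have h2 : (1 - w + w ^ 2 / 6).im = -w.im + w.re * w.im / 3 := by
      simp [pow_two]; ring
    have hsc : Real.sin θ ^ 2 = 1 - Real.cos θ ^ 2 := Real.sin_sq θ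
    have hr : saddle ^ 2 = 4 * saddle - 2 := by
      unfold saddle; linear_combination hs2
    rw [Complex.sq_norm, Complex.normSq_apply, h1, h2, hwre, hwim]
    generalize Real.cos θ = c at *
    generalize Real.sin θ = s at *
    generalize saddle = r at *
    have e : s ^ 4 = (1 - c ^ 2) ^ 2 := by rw [← hsc]; ring
    ring_nf
    rw [e, hsc]
    have hr3 : r ^ 3 = 4 * r ^ 2 - 2 * r := by linear_combination r * hr
    have hr4 : r ^ 4 = 4 * r ^ 3 - 2 * r ^ 2 := by linear_combination r ^ 2 * hr
    ring_nf
    simp only [hr4, hr3, hr]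
    ring
  have hcos : 1 / 5 * θ ^ 2 ≤ 1 - Real.cos θ := by
    have h1 := Real.cos_le_one_sub_mul_cos_sq (abs_le.mpr hθ)
    have h2 : 1 / 5 ≤ 2 / Real.pi ^ 2 := by
      rw [div_le_div_iff₀ (by norm_num) (by positivity)]
      nlinarith [Real.pi_lt_d2, Real.pi_pos]
    nlinarith [mul_le_mul_of_nonneg_right h2 (sq_nonneg θ)]
  have hθ2 : θ ^ 2 ≤ 10 := by
    have := sq_le_sq' hθ.1 hθ.2
    nlinarith [Real.pi_lt_d2, Real.pi_pos]
  rw [hnorm, le_div_iff₀ (by positivity)]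
  refine le_of_sq_le_sq ?_ (norm_nonneg _)
  rw [hsq, mul_pow, div_pow, hs2]
  have hcos1 := Real.cos_le_one θ
  have hA : 6 / 5 ≤ 2 * (1 + saddle ^ 2 / 6) - 2 * saddle / 3 * (1 + Real.cos θ) := by
    nlinarith [Real.neg_one_le_cos θ]
  have hB : (1 / 5 * θ ^ 2) * (1 / 2) * (6 / 5) ≤ (1 - Real.cos θ) * saddle *
      (2 * (1 + saddle ^ 2 / 6) - 2 * saddle / 3 * (1 + Real.cos θ)) := by
    gcongr
  nlinarith [mul_nonneg (sq_nonneg θ) (sub_nonneg.mpr hθ2)]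

lemma tendsto_saddleRatio :
    Tendsto (fun θ : ℝ => (saddleRatio θ - 1) / (θ : ℂ) ^ 2) (𝓝[≠] 0)
      (𝓝 ((3 * saddle / 2 : ℝ) : ℂ)) := by
  have hslope := (hasDerivAt_circleMap 0 saddle 0).tendsto_slope_zero
  simp only [zero_add, circleMap_saddle_zero] at hslope
  have hcont : Tendsto (fun θ : ℝ => circleMap 0 saddle θ) (𝓝[≠] 0) (𝓝 saddle) := by
    have := (continuous_circleMap 0 saddle).tendsto 0
    rw [circleMap_saddle_zero] at this
    exact this.mono_left nhdsWithin_le_nhds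
  have hrho : (rho : ℂ) ≠ 0 := by exact_mod_cast rho_pos.ne'
  have hlim := (hslope.pow 2).mul
    (((((hcont.sub_const (saddle : ℂ)).div_const 6).const_add (-((√2 : ℝ) : ℂ) / 2))).div_const
      (rho : ℂ))
  have hval : ((saddle : ℂ) * Complex.I) ^ 2 *
      ((-((√2 : ℝ) : ℂ) / 2 + ((saddle : ℂ) - saddle) / 6) / rho)
      = ((3 * saddle / 2 : ℝ) : ℂ) := by
    have hs : (saddle : ℂ) ≠ 0 := by exact_mod_cast saddle_pos.ne'
    have h2 : ((√2 : ℝ) : ℂ) ≠ 0 := by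
      exact_mod_cast (Real.sqrt_pos.mpr (by norm_num : (0 : ℝ) < 2)).ne'
    rw [mul_pow, Complex.I_sq, rho_eq]
    push_cast
    field_simp
    ring
  rw [hval] at hlim
  refine hlim.congr' ?_
  filter_upwards [self_mem_nhdsWithin] with θ hθ
  have hθ' : (θ : ℂ) ≠ 0 := by exact_mod_cast hθ
  rw [saddleRatio, cubic_eq_taylor, Complex.real_smul, Complex.ofReal_inv]
  field_simp
  ring

lemma rho_pow_mul_contourIntegral (i : ℤ) (k : ℕ) :
    (rho : ℂ) ^ k * contourIntegral i k
      = (2 * Real.pi : ℂ)⁻¹ * ∫ θ in -Real.pi..Real.pi, amplitude i θ * (saddleRatio θ ^ k)⁻¹ := by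
  have hrho : (rho : ℂ) ≠ 0 := by exact_mod_cast rho_pos.ne'
  have hper : Function.Periodic (fun θ => amplitude i θ * (saddleRatio θ ^ k)⁻¹)
      (2 * Real.pi) := fun θ => by
    simp only [amplitude, saddleRatio, periodic_circleMap 0 saddle θ]
  have hshift := hper.intervalIntegral_add_eq (-Real.pi) 0
  rw [show -Real.pi + 2 * Real.pi = Real.pi by ring, zero_add] at hshift
  rw [hshift, contourIntegral, circleIntegral]
  have hint : ∀ θ : ℝ, deriv (circleMap 0 saddle) θ •
      ((1 - circleMap 0 saddle θ) ^ (1 - i) * (cubic (circleMap 0 saddle θ) ^ (k + 1))⁻¹)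
      = (Complex.I * ((rho : ℂ) ^ k)⁻¹) * (amplitude i θ * (saddleRatio θ ^ k)⁻¹) := fun θ => by
    have hz := cubic_ne_zero_of_norm_eq (norm_circleMap_saddle θ)
    rw [deriv_circleMap, smul_eq_mul, amplitude, saddleRatio, div_pow]
    field_simp
    ring
  simp only [hint]
  rw [intervalIntegral.integral_const_mul]
  have hI := Complex.I_ne_zero
  have hpi : (Real.pi : ℂ) ≠ 0 := by exact_mod_cast Real.pi_ne_zero
  field_simp

/-! ### Asymptotics -/

/-- The saddle point contribution is `γ_i`. -/
lemma saddle_contribution (i : ℤ) :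
    (2 * Real.pi)⁻¹ * ((√2 - 1) ^ (1 - i) * (3 / √2) * √(2 * Real.pi / (3 * saddle)))
      = gamma i := by
  have hs2 : √2 ^ 2 = 2 := Real.sq_sqrt (by norm_num)
  have hs0 : 0 < √2 := by positivity
  have hx : 0 < √2 - 1 := by
    have : 1 < √2 := by rw [Real.lt_sqrt (by norm_num)]; norm_num
    linarith
  have hsad : saddle = √2 * (√2 - 1) := by unfold saddle; linear_combination -hs2
  have hpi := Real.pi_pos
  have hroot : √(2 * Real.pi / (3 * saddle))
      = √(3 / (√2 * Real.pi) * (√2 - 1)) * (Real.pi * √2 / (3 * (√2 - 1))) := by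
    rw [← Real.sqrt_sq (by positivity : 0 ≤ Real.pi * √2 / (3 * (√2 - 1))),
      ← Real.sqrt_mul (by positivity), hsad]
    congr 1
    generalize √2 - 1 = x at *
    generalize √2 = s at *
    field_simp
    linear_combination -hs2
  rw [hroot, gamma, gammaZero, one_div, inv_zpow', zpow_sub₀ hx.ne', zpow_one, zpow_neg]
  field_simp

lemma gamma_ne_zero (i : ℤ) : gamma i ≠ 0 := by
  have hx : 0 < √2 - 1 := by
    have : 1 < √2 := by rw [Real.lt_sqrt (by norm_num)]; norm_num
    linarith
  have := Real.pi_pos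
  unfold gamma gammaZero
  positivity

theorem tendsto_sqrt_mul_contourIntegral (i : ℤ) :
    Tendsto (fun k : ℕ => (√(k : ℝ) : ℂ) * ((rho : ℂ) ^ k * contourIntegral i k)) atTop
      (𝓝 (gamma i : ℂ)) := by
  have h := (tendsto_sqrt_mul_integral_inv_pow (continuous_amplitude i) continuous_saddleRatio
    (by norm_num : (0 : ℝ) < 1 / 20) (fun θ hθ => one_add_sq_le_norm_saddleRatio hθ)
    tendsto_saddleRatio).const_mul (2 * Real.pi : ℂ)⁻¹
  have hamp : amplitude i 0 = (((√2 - 1) ^ (1 - i) * (3 / √2) : ℝ) : ℂ) := by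
    have h1 : (1 : ℂ) - saddle = ((√2 - 1 : ℝ) : ℂ) := by
      unfold saddle; push_cast; ring
    have hs : (saddle : ℂ) ≠ 0 := by exact_mod_cast saddle_pos.ne'
    rw [amplitude, circleMap_saddle_zero, cubic_saddle, h1, rho_eq]
    push_cast
    field_simp
  have hlim : (2 * Real.pi : ℂ)⁻¹ * (amplitude i 0 * (√(2 * Real.pi / (3 * saddle)) : ℝ))
      = (gamma i : ℂ) := by
    rw [← saddle_contribution i, hamp]
    push_cast
    ring
  rw [hlim] at h
  refine h.congr fun k => ?_
  rw [rho_pow_mul_contourIntegral]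
  ring

end ArchProcess

/-- For every fixed integer `i`, `t_{k+i,k} ∼ γ_i ρ^{-k} k! / √k` as `k → ∞`.
The first index `k + i` is a natural number as soon as `k ≥ -i`, and for those `k` the truncation
`Int.toNat` does nothing. -/
theorem mainTheorem3 (i : ℤ) :
    Asymptotics.IsEquivalent Filter.atTop
      (fun k : ℕ => (ArchProcess.t ((k : ℤ) + i).toNat k : ℝ))
      (fun k : ℕ => ArchProcess.gamma i * (ArchProcess.rho ^ (-(k : ℤ)) / √(k : ℝ))
        * (k.factorial : ℝ)) := by
  have hγ := ArchProcess.gamma_ne_zero i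
  have hre : Tendsto (fun k : ℕ => √(k : ℝ) *
      (ArchProcess.rho ^ k * (ArchProcess.contourIntegral i k).re)) atTop
      (𝓝 (ArchProcess.gamma i)) := by
    have h := (Complex.continuous_re.tendsto _).comp
      (ArchProcess.tendsto_sqrt_mul_contourIntegral i)
    refine h.congr fun k => ?_
    simp only [Function.comp, ← Complex.ofReal_pow, Complex.re_ofReal_mul]
  have heq := ((Asymptotics.isEquivalent_const_iff_tendsto hγ).mpr hre).mul
    (Asymptotics.IsEquivalent.refl (u := fun k : ℕ =>
      ArchProcess.rho ^ (-(k : ℤ)) / √(k : ℝ) * (k.factorial : ℝ)) (l := atTop))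
  refine (heq.congr_left ?_).congr_right ?_
  · filter_upwards [eventually_gt_atTop 0, eventually_ge_atTop (-i).toNat] with k hk hki
    have hn : ((((k : ℤ) + i).toNat : ℕ) : ℤ) - k = i := by omega
    have ht := congrArg Complex.re (ArchProcess.t_eq_factorial_mul ((k : ℤ) + i).toNat k)
    rw [hn, Complex.ratCast_re, ← Complex.ofReal_natCast, Complex.re_ofReal_mul] at ht
    have hk' : √(k : ℝ) ≠ 0 := (Real.sqrt_pos.mpr (by exact_mod_cast hk)).ne'
    have hρ := ArchProcess.rho_pos.ne'
    simp only [Pi.mul_apply]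
    rw [ht, zpow_neg, zpow_natCast]
    field_simp
  · refine Eventually.of_forall fun k => ?_
    simp only [Pi.mul_apply, Function.const]
    ring
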